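/- Let $\alpha\in[0,1)$. For a finite simple connected graph $G$ with vertex set $V(G)$ and distance function $d_G$, let $D(G)=(d_G(u,v))_{u,v\in V(G)}$ be its distance matrix, let $T(G)$ be the diagonal matrix whose entry at $u$ is the transmission $T_G(u)=\sum_{v\in V(G)}d_G(u,v)$, let $D_\alpha(G)=\alpha T(G)+(1-\alpha)D(G)$, and let $\mu_\alpha(G)$ be the largest eigenvalue of $D_\alpha(G)$. For integers $2\le\omega\le n$, let $Ki_{n,\omega}$ be the graph obtained from the complete graph $K_\omega$ and a path $P_{n-\omega}$ by adding an edge between a vertex of $K_\omega$ and a terminal vertex of $P_{n-\omega}$ if $\omega<n$, and let $Ki_{n,n}=K_n$. Theorem. Let $2\le\omega\le n$. Then $Ki_{n,\omega}$ is a connected graph of order $n$ with clique number $\omega$, and for every connected graph $G$ of order $n$ with clique number $\omega$, $$\mu_\alpha(G)\le\mu_\alpha(Ki_{n,\omega}),$$ with equality if and only if $G\cong Ki_{n,\omega}$. -/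

import Mathlib

/-- The matrix `D_α(G) = α T(G) + (1 - α) D(G)`, where `D(G)` is the distance matrix of `G` and
`T(G)` is the diagonal matrix of the transmissions `T_G(u) = ∑ v, d_G(u, v)`. -/
noncomputable def distAlphaMatrix {V : Type*} [Fintype V] [DecidableEq V]
    (α : ℝ) (G : SimpleGraph V) : Matrix V V ℝ :=
  α • Matrix.diagonal (fun u => ∑ v, (G.dist u v : ℝ)) +
    (1 - α) • Matrix.of (fun u v => (G.dist u v : ℝ))

/-- The distance `α`-spectral radius `μ_α(G)`: the largest eigenvalue of `D_α(G)`. -/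
noncomputable def distAlphaRadius {V : Type*} [Fintype V] [DecidableEq V]
    (α : ℝ) (G : SimpleGraph V) : ℝ :=
  sSup {μ : ℝ | Module.End.HasEigenvalue (Matrix.toLin' (distAlphaMatrix α G)) μ}

/-- The supremum in the definition of `distAlphaRadius` is attained: it is the largest
eigenvalue. -/
theorem isGreatest_distAlphaRadius {V : Type*} [Fintype V] [DecidableEq V] [Nonempty V]
    (α : ℝ) (G : SimpleGraph V) :
    IsGreatest {μ : ℝ | Module.End.HasEigenvalue (Matrix.toLin' (distAlphaMatrix α G)) μ}
      (distAlphaRadius α G) := by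
  have hH : (distAlphaMatrix α G).IsHermitian := by
    ext i j
    simp only [distAlphaMatrix, Matrix.conjTranspose_apply, Matrix.add_apply, Matrix.smul_apply,
      Matrix.of_apply, star_trivial, Matrix.diagonal_apply, G.dist_comm (u := j) (v := i)]
    by_cases h : i = j
    · subst h; rfl
    · rw [if_neg h, if_neg (Ne.symm h)]
  have hfin : {μ : ℝ | Module.End.HasEigenvalue
      (Matrix.toLin' (distAlphaMatrix α G)) μ}.Finite :=
    Module.End.finite_hasEigenvalue _
  have hne : {μ : ℝ | Module.End.HasEigenvalue
      (Matrix.toLin' (distAlphaMatrix α G)) μ}.Nonempty := by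
    obtain ⟨i⟩ := ‹Nonempty V›
    refine ⟨hH.eigenvalues i, ?_⟩
    change Module.End.HasEigenvalue _ _
    rw [Module.End.hasEigenvalue_iff_mem_spectrum, Matrix.spectrum_toLin']
    exact hH.eigenvalues_mem_spectrum_real i
  exact ⟨hne.csSup_mem hfin, fun _ hx => le_csSup hfin.bddAbove hx⟩

/-- The graph `Ki_{n,ω}` (for `2 ≤ ω ≤ n`) on the vertices `0, …, n - 1`: the vertices below `ω`
form a complete graph `K_ω`, the vertices `ω, …, n - 1` form in this order a path `P_{n-ω}`, and,
if `ω < n`, the vertex `ω - 1` of `K_ω` is joined to the terminal vertex `ω` of this path.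
(The edges `{i, i + 1}` with `i + 1 < ω` are already edges of `K_ω`.) -/
def kiteGraph (n ω : ℕ) : SimpleGraph (Fin n) where
  Adj i j := i ≠ j ∧
    (((i : ℕ) < ω ∧ (j : ℕ) < ω) ∨ (i : ℕ) + 1 = (j : ℕ) ∨ (j : ℕ) + 1 = (i : ℕ))
  symm := ⟨fun i j h => ⟨h.1.symm, by
    rcases h.2 with h | h | h
    · exact Or.inl ⟨h.2, h.1⟩
    · exact Or.inr (Or.inr h)
    · exact Or.inr (Or.inl h)⟩⟩
  loopless := ⟨fun _ h => h.1 rfl⟩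

/-! For a positive eigenvector `x` of `D_α(G)`, the Rayleigh quotient turns the comparison of
spectral radii into one of distance sums `∑ w(u,v) d(u,v)` with positive weights `α x_u² + (1 - α)
x_u x_v`. It suffices that, for arbitrary positive weights, some kite on the same vertices has at
least the sum of `G`, with equality only for the same distances (`DominatedByKites`).

Starting from an `ω`-clique, vertices are added one at a time (`DominatedByKites.insert_vertex`). A
new vertex `z` adjacent to `y` satisfies `d(z,u) ≤ 1 + d(y,u)`. Moving the weights of `z` to `y` and
using induction bounds `G` by a kite with a pendant vertex at `y`. Either this is again a kite, or a
weighted average of two kite distances dominates its distance, strictly at some pair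
(`exists_renumbering`), so one of these kites has a strictly larger sum. -/

open scoped Matrix

/-! ### Distances in kites and in kites with a pendant vertex -/

/-- The distance in the kite graph with clique `{0, …, ω - 1}` and tail `ω - 1, ω, …`. -/
def kiteDist (ω i j : ℕ) : ℕ := if i = j then 0 else max 1 (max i j - max (min i j) (ω - 2))

/-- The distance in the graph obtained from the kite graph on `{0, …, k - 1}` by joining a new
vertex `k` to the vertex `y`. -/
def pendantKiteDist (ω k y i j : ℕ) : ℕ :=
  if i = j then 0 else if i = k then 1 + kiteDist ω y j else if j = k then 1 + kiteDist ω i y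
  else kiteDist ω i j

theorem kiteDist_comm (ω i j : ℕ) : kiteDist ω i j = kiteDist ω j i := by
  unfold kiteDist; simp only [eq_comm (a := i), max_comm i, min_comm i]

theorem kiteDist_of_eq {ω i j : ℕ} (h : i = j) : kiteDist ω i j = 0 := if_pos h

theorem kiteDist_clique {ω i j : ℕ} (hij : i ≠ j) (hi : i < ω) (hj : j < ω) :
    kiteDist ω i j = 1 := by
  unfold kiteDist; rw [if_neg hij]; omega

theorem kiteDist_tail {ω i j : ℕ} (hi : ω ≤ i + 1) (hij : i ≤ j) : kiteDist ω i j = j - i := by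
  unfold kiteDist; split_ifs <;> omega

theorem kiteDist_tail' {ω i j : ℕ} (hj : ω ≤ j + 1) (hij : j ≤ i) : kiteDist ω i j = i - j := by
  rw [kiteDist_comm, kiteDist_tail hj hij]

/-- Seen from the tail, every clique vertex other than `ω - 1` acts as a path vertex at position `ω
- 2`; hence the cut-off in `kiteDist`. -/
theorem kiteDist_cross {ω i j : ℕ} (hi : i + 1 < ω) (hj : ω ≤ j + 1) :
    kiteDist ω i j = j + 2 - ω := by
  unfold kiteDist; split_ifs <;> omega

theorem kiteDist_cross' {ω i j : ℕ} (hj : j + 1 < ω) (hi : ω ≤ i + 1) :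
    kiteDist ω i j = i + 2 - ω := by
  rw [kiteDist_comm, kiteDist_cross hj hi]

theorem pendantKiteDist_comm (ω k y i j : ℕ) :
    pendantKiteDist ω k y i j = pendantKiteDist ω k y j i := by
  unfold pendantKiteDist
  by_cases h : i = j
  · subst h; rfl
  · by_cases hi : i = k
    · subst hi
      simp [h, Ne.symm h, kiteDist_comm ω y j]
    · by_cases hj : j = k
      · subst hj
        simp [h, Ne.symm h, kiteDist_comm ω y i]
      · simp [h, Ne.symm h, hi, hj, kiteDist_comm ω i j]

/-! ### Bounding a pendant kite by kites -/

/-- `σ` permutes `{0, …, k - 1}`. -/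
structure IsRenumbering (k : ℕ) (σ : ℕ → ℕ) : Prop where
  lt : ∀ i < k, σ i < k
  inj : ∀ i < k, ∀ j < k, σ i = σ j → i = j

/-- A gain of `b` weighted by `a` offsets a loss of `a` weighted by `b`. -/
theorem weighted_le {a b e d₁ d₂ : ℕ}
    (h : (e ≤ d₁ ∧ e ≤ d₂) ∨ (e + b ≤ d₁ ∧ e ≤ d₂ + a) ∨ (e ≤ d₁ + b ∧ e + a ≤ d₂)) :
    (a + b) * e ≤ a * d₁ + b * d₂ := by
  rcases h with ⟨h1, h2⟩ | ⟨h1, h2⟩ | ⟨h1, h2⟩ <;>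
  nlinarith [Nat.mul_le_mul_left a h1, Nat.mul_le_mul_left b h2]

theorem tail_case {ω k y : ℕ} (hω : 2 ≤ ω) (h1 : ω ≤ y + 1) (h2 : y + 1 < k) :
    ∃ σ₁ σ₂ : ℕ → ℕ, IsRenumbering (k + 1) σ₁ ∧ IsRenumbering (k + 1) σ₂ ∧ ∃ a b : ℕ,
      (∀ i < k + 1, ∀ j < k + 1, (a + b) * pendantKiteDist ω k y i j ≤
        a * kiteDist ω (σ₁ i) (σ₁ j) + b * kiteDist ω (σ₂ i) (σ₂ j)) ∧
      ∃ i < k + 1, ∃ j < k + 1, (a + b) * pendantKiteDist ω k y i j <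
        a * kiteDist ω (σ₁ i) (σ₁ j) + b * kiteDist ω (σ₂ i) (σ₂ j) := by
  -- The first kite inserts `k` into the path just before `y`; the second reverses the segment `y,
  -- …, k - 1` and puts `k` after `y`. For `i < y`, the distance to `k` drops by 1 in the first and
  -- grows by `k - y - 1` in the second, which dictates the weights.
  refine ⟨fun i => if i < y then i else if i = k then y else i + 1,
    fun i => if i < y then i else if i = k then k else y + (k - 1 - i),
    ⟨fun i hi => ?_, fun i hi j hj h => ?_⟩, ⟨fun i hi => ?_, fun i hi j hj h => ?_⟩,
    k - y - 1, 1, ?_, 0, by omega, y, by omega, ?_⟩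
  · split_ifs <;> omega
  · split_ifs at h <;> omega
  · split_ifs <;> omega
  · split_ifs at h <;> omega
  · intro i hi j hj
    wlog hij : i ≤ j generalizing i j
    · have := this j hj i hi (by omega)
      simpa only [pendantKiteDist_comm ω k y i j, kiteDist_comm ω (ite (i < y) _ _)] using this
    apply weighted_le
    rcases hij.eq_or_lt with rfl | hij
    · left; simp [pendantKiteDist]
    have hik : i ≠ k := by omega
    by_cases hiy : i < y <;> by_cases hjy : j < y <;> by_cases hjk : j = k <;>
      simp only [pendantKiteDist, hij.ne, hik, hiy, hjy, hjk, if_true, if_false] <;>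
      unfold kiteDist <;> split_ifs <;> omega
  -- The pair `0, y` gains in both kites: 1 in the first, `k - 1 - y` in the second.
  · have : 0 < y := by omega
    have h3 : y ≠ k := by omega
    have h4 : 0 ≠ k := by omega
    have h5 : 0 ≠ y := by omega
    simp only [pendantKiteDist, this, h3, h4, h5, if_true, if_false, lt_irrefl]
    have e1 : kiteDist ω 0 y = y - (ω - 2) := by unfold kiteDist; split_ifs <;> omega
    have e2 : kiteDist ω 0 (y + 1) = y - (ω - 2) + 1 := by unfold kiteDist; split_ifs <;> omega
    have e3 : kiteDist ω 0 (y + (k - 1 - y)) = y - (ω - 2) + (k - 1 - y) := by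
      unfold kiteDist; split_ifs <;> omega
    rw [e1, e2, e3]
    obtain ⟨m, rfl⟩ := Nat.exists_eq_add_of_lt h2
    rw [show y + 1 + m + 1 - y - 1 = m + 1 by omega, show y + 1 + m + 1 - 1 - y = m + 1 by omega]
    nlinarith

/-- The old attachment vertex `ω - 1` leaves the clique for the tail, which now starts from `y`, and
`k` joins the clique. -/
theorem clique_renumbering₁ {ω k y : ℕ} (h1 : y + 1 < ω) (h2 : ω ≤ k) :
    IsRenumbering (k + 1) (fun i => if i = k then y else if i = y then ω - 1 else
      if i < ω - 1 then i else i + 1) := by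
  refine ⟨fun i hi => ?_, fun i hi j hj h => ?_⟩
  · split_ifs <;> omega
  · split_ifs at h <;> omega

/-- When `ω < k`, the tail is reversed: its end `k - 1` joins the clique, `k - 2` becomes the
attachment vertex, and the path ends with `ω - 1, y, k`. -/
theorem clique_renumbering₂ {ω k y : ℕ} (h1 : y + 1 < ω) (h2 : ω ≤ k) :
    IsRenumbering (k + 1) (fun i => if i = k then k else if i = y then k - 1 else
      if i < ω - 1 then i else if i = k - 1 then y else k + ω - 3 - i) := by
  refine ⟨fun i hi => ?_, fun i hi j hj h => ?_⟩
  · split_ifs <;> omega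
  · split_ifs at h <;> omega

theorem clique_renumbering_cases {ω k y : ℕ} (h1 : y + 1 < ω) (h2 : ω ≤ k) (i : ℕ)
    (hi : i < k + 1) :
    let s := if i = k then y else if i = y then ω - 1 else if i < ω - 1 then i else i + 1
    let t := if i = k then k else if i = y then k - 1 else
      if i < ω - 1 then i else if i = k - 1 then y else k + ω - 3 - i
    ((i < ω - 1 ∧ i ≠ y) ∧ s = i ∧ t = i) ∨ (i = y ∧ s = ω - 1 ∧ t = k - 1) ∨
    (i = k ∧ s = y ∧ t = k) ∨ ((ω - 1 ≤ i ∧ i < k - 1) ∧ s = i + 1 ∧ t = k + ω - 3 - i) ∨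
    (i = k - 1 ∧ s = k ∧ t = y) := by
  intro s t
  simp only [s, t]
  split_ifs <;> omega

theorem clique_case {ω k y : ℕ} (hω : 3 ≤ ω) (h1 : y + 1 < ω) (h2 : ω < k) :
    ∃ σ₁ σ₂ : ℕ → ℕ, IsRenumbering (k + 1) σ₁ ∧ IsRenumbering (k + 1) σ₂ ∧ ∃ a b : ℕ,
      (∀ i < k + 1, ∀ j < k + 1, (a + b) * pendantKiteDist ω k y i j ≤
        a * kiteDist ω (σ₁ i) (σ₁ j) + b * kiteDist ω (σ₂ i) (σ₂ j)) ∧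
      ∃ i < k + 1, ∃ j < k + 1, (a + b) * pendantKiteDist ω k y i j <
        a * kiteDist ω (σ₁ i) (σ₁ j) + b * kiteDist ω (σ₂ i) (σ₂ j) := by
  -- From a third clique vertex, the distance to `k` loses 1 and gains `k - ω`, while that to `k -
  -- 1` gains 1 and loses `k - ω`; the weights balance both. Its distance to `y` is unchanged in the
  -- first kite and grows in the second, giving strictness; such a vertex exists as `ω ≥ 3`.
  refine ⟨_, _, clique_renumbering₁ h1 h2.le, clique_renumbering₂ h1 h2.le,
    k - ω, 1, ?_, if y = 0 then 1 else 0, by split_ifs <;> omega, y, by omega, ?_⟩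
  · intro i hi j hj
    wlog hij : i ≤ j generalizing i j
    · have := this j hj i hi (by omega)
      simpa only [pendantKiteDist_comm ω k y i j, kiteDist_comm ω (ite (i = k) _ _)] using this
    apply weighted_le
    rcases hij.eq_or_lt with rfl | hij
    · left; simp [pendantKiteDist]
    rcases clique_renumbering_cases h1 h2.le i hi with ⟨hi', ei₁, ei₂⟩ | ⟨hi', ei₁, ei₂⟩ |
      ⟨hi', ei₁, ei₂⟩ | ⟨hi', ei₁, ei₂⟩ | ⟨hi', ei₁, ei₂⟩ <;>
    rcases clique_renumbering_cases h1 h2.le j hj with ⟨hj', ej₁, ej₂⟩ | ⟨hj', ej₁, ej₂⟩ |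
      ⟨hj', ej₁, ej₂⟩ | ⟨hj', ej₁, ej₂⟩ | ⟨hj', ej₁, ej₂⟩ <;>
    first
    | omega
    | rw [ei₁, ei₂, ej₁, ej₂]
      have hik : i ≠ k := by omega
      by_cases hjk : j = k <;> simp only [pendantKiteDist, hij.ne, hik, hjk, if_true, if_false] <;>
      simp (disch := omega) only [kiteDist_clique, kiteDist_tail, kiteDist_tail',
        kiteDist_cross, kiteDist_cross', kiteDist_of_eq] <;> omega
  · obtain ⟨c, hc, hc'⟩ : ∃ c, (if y = 0 then 1 else 0) = c ∧ (c < ω - 1 ∧ c ≠ y) :=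
      ⟨_, rfl, by split_ifs <;> omega⟩
    rw [hc]
    have e1 : kiteDist ω c (ω - 1) = 1 := by unfold kiteDist; split_ifs <;> omega
    have e2 : kiteDist ω c (k - 1) = k - ω + 1 := by unfold kiteDist; split_ifs <;> omega
    have e3 : kiteDist ω c y = 1 := by unfold kiteDist; split_ifs <;> omega
    rcases clique_renumbering_cases h1 h2.le c (by omega) with ⟨hi', ei₁, ei₂⟩ | ⟨hi', ei₁, ei₂⟩ |
      ⟨hi', ei₁, ei₂⟩ | ⟨hi', ei₁, ei₂⟩ | ⟨hi', ei₁, ei₂⟩ <;> try omega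
    rcases clique_renumbering_cases h1 h2.le y (by omega) with ⟨hj', ej₁, ej₂⟩ | ⟨hj', ej₁, ej₂⟩ |
      ⟨hj', ej₁, ej₂⟩ | ⟨hj', ej₁, ej₂⟩ | ⟨hj', ej₁, ej₂⟩ <;> try omega
    rw [ei₁, ei₂, ej₁, ej₂, e1, e2, pendantKiteDist, if_neg hc'.2, if_neg (by omega),
      if_neg (by omega), e3]
    omega

theorem exists_renumbering {ω k y : ℕ} (hω : 2 ≤ ω) (hk : ω ≤ k) (hy : y < k) :
    (∃ σ, IsRenumbering (k + 1) σ ∧ ∀ i < k + 1, ∀ j < k + 1,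
      pendantKiteDist ω k y i j = kiteDist ω (σ i) (σ j)) ∨
    ∃ σ₁ σ₂ : ℕ → ℕ, IsRenumbering (k + 1) σ₁ ∧ IsRenumbering (k + 1) σ₂ ∧ ∃ a b : ℕ,
      (∀ i < k + 1, ∀ j < k + 1, (a + b) * pendantKiteDist ω k y i j ≤
        a * kiteDist ω (σ₁ i) (σ₁ j) + b * kiteDist ω (σ₂ i) (σ₂ j)) ∧
      ∃ i < k + 1, ∃ j < k + 1, (a + b) * pendantKiteDist ω k y i j <
        a * kiteDist ω (σ₁ i) (σ₁ j) + b * kiteDist ω (σ₂ i) (σ₂ j) := by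
  by_cases h1 : ω ≤ y + 1
  · by_cases h2 : y + 1 < k
    · exact Or.inr (tail_case hω h1 h2)
    · left
      refine ⟨id, ⟨fun i hi => hi, fun i _ j _ h => h⟩, fun i hi j hj => ?_⟩
      simp only [id, pendantKiteDist, kiteDist]
      split_ifs <;> omega
  -- In these cases the pendant kite is a kite: a path extended at its other end, or a complete
  -- graph with one pendant vertex.
  · by_cases h3 : ω = 2 ∨ ω = k
    · left
      obtain ⟨σ, hσ, h⟩ : ∃ σ, IsRenumbering (k + 1) σ ∧ ∀ i j, i < j → j < k + 1 →
          pendantKiteDist ω k y i j = kiteDist ω (σ i) (σ j) := by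
        rcases h3 with h3 | h3
        · refine ⟨_, clique_renumbering₁ (y := y) (by omega) hk, fun i j hij hj => ?_⟩
          rcases clique_renumbering_cases (y := y) (by omega) hk i (by omega) with ⟨hi', ei₁, ei₂⟩ |
            ⟨hi', ei₁, ei₂⟩ | ⟨hi', ei₁, ei₂⟩ | ⟨hi', ei₁, ei₂⟩ | ⟨hi', ei₁, ei₂⟩ <;>
          rcases clique_renumbering_cases (y := y) (by omega) hk j hj with ⟨hj', ej₁, ej₂⟩ |
            ⟨hj', ej₁, ej₂⟩ | ⟨hj', ej₁, ej₂⟩ | ⟨hj', ej₁, ej₂⟩ | ⟨hj', ej₁, ej₂⟩ <;>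
          first
          | omega
          | rw [ei₁, ej₁]
            have hik : i ≠ k := by omega
            by_cases hjk : j = k <;>
            simp only [pendantKiteDist, hij.ne, hik, hjk, if_true, if_false] <;>
            simp (disch := omega) only [kiteDist_clique, kiteDist_tail,
              kiteDist_cross, kiteDist_cross', kiteDist_of_eq] <;> omega
        · refine ⟨_, clique_renumbering₂ (y := y) (by omega) hk, fun i j hij hj => ?_⟩
          rcases clique_renumbering_cases (y := y) (by omega) hk i (by omega) with ⟨hi', ei₁, ei₂⟩ |
            ⟨hi', ei₁, ei₂⟩ | ⟨hi', ei₁, ei₂⟩ | ⟨hi', ei₁, ei₂⟩ | ⟨hi', ei₁, ei₂⟩ <;>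
          rcases clique_renumbering_cases (y := y) (by omega) hk j hj with ⟨hj', ej₁, ej₂⟩ |
            ⟨hj', ej₁, ej₂⟩ | ⟨hj', ej₁, ej₂⟩ | ⟨hj', ej₁, ej₂⟩ | ⟨hj', ej₁, ej₂⟩ <;>
          first
          | omega
          | rw [ei₂, ej₂]
            have hik : i ≠ k := by omega
            by_cases hjk : j = k <;>
            simp only [pendantKiteDist, hij.ne, hik, hjk, if_true, if_false] <;>
            simp (disch := omega) only [kiteDist_clique, kiteDist_tail,
              kiteDist_cross, kiteDist_of_eq]
            omega
      refine ⟨σ, hσ, fun i hi j hj => ?_⟩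
      rcases lt_trichotomy i j with hij | rfl | hij
      · exact h i j hij hj
      · simp [pendantKiteDist, kiteDist_of_eq]
      · rw [pendantKiteDist_comm, kiteDist_comm, h j i hij hi]
    · exact Or.inr (clique_case (by omega) (by omega) (by omega))

/-! ### Domination of distances for arbitrary positive weights -/

/-- A strict convex bound on `e` by `d₁` and `d₂` makes one of the weighted sums of `d₁` and `d₂`
larger than that of `e`. -/
theorem sum_lt_or_sum_lt {ι : Type*} (T : Finset ι) (w : ι → ℝ) (hw : ∀ i ∈ T, 0 < w i)
    (e d₁ d₂ : ι → ℕ) (a b : ℕ) (hle : ∀ i ∈ T, (a + b) * e i ≤ a * d₁ i + b * d₂ i)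
    (hlt : ∃ i ∈ T, (a + b) * e i < a * d₁ i + b * d₂ i) :
    ∑ i ∈ T, w i * e i < ∑ i ∈ T, w i * d₁ i ∨ ∑ i ∈ T, w i * e i < ∑ i ∈ T, w i * d₂ i := by
  by_contra! h
  obtain ⟨i, hi, hlt⟩ := hlt
  have key : ∑ i ∈ T, w i * ((a + b) * e i : ℝ) < ∑ i ∈ T, w i * (a * d₁ i + b * d₂ i : ℝ) := by
    refine Finset.sum_lt_sum (fun j hj => ?_) ⟨i, hi, ?_⟩
    · exact mul_le_mul_of_nonneg_left (by exact_mod_cast hle j hj) (hw j hj).le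
    · exact mul_lt_mul_of_pos_left (by exact_mod_cast hlt) (hw i hi)
  have e1 : ∑ i ∈ T, w i * ((a + b) * e i : ℝ) = (a + b) * ∑ i ∈ T, w i * e i := by
    rw [Finset.mul_sum]; exact Finset.sum_congr rfl fun j _ => by ring
  have e2 : ∑ i ∈ T, w i * (a * d₁ i + b * d₂ i : ℝ) =
      a * ∑ i ∈ T, w i * d₁ i + b * ∑ i ∈ T, w i * d₂ i := by
    rw [Finset.mul_sum, Finset.mul_sum, ← Finset.sum_add_distrib]
    exact Finset.sum_congr rfl fun j _ => by ring
  rw [e1, e2] at key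
  nlinarith [mul_le_mul_of_nonneg_left h.1 (Nat.cast_nonneg (α := ℝ) a),
    mul_le_mul_of_nonneg_left h.2 (Nat.cast_nonneg (α := ℝ) b)]

/-- `p` numbers the elements of `S` by `0, …, |S| - 1`. -/
structure IsNumbering {V : Type*} (S : Finset V) (p : V → ℕ) : Prop where
  lt : ∀ u ∈ S, p u < S.card
  inj : ∀ u ∈ S, ∀ v ∈ S, p u = p v → u = v

/-- Whatever the positive weights are, some kite on `S` has a weighted sum of distances at least
that of `d`, with equality only if `d` is the distance of this kite. -/
def DominatedByKites {V : Type*} (ω : ℕ) (d : V → V → ℕ) (S : Finset V) : Prop :=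
  ∀ w : V × V → ℝ, (∀ q, 0 < w q) → ∃ p : V → ℕ, IsNumbering S p ∧
    ∑ q ∈ S ×ˢ S, w q * d q.1 q.2 ≤ ∑ q ∈ S ×ˢ S, w q * kiteDist ω (p q.1) (p q.2) ∧
    (∑ q ∈ S ×ˢ S, w q * d q.1 q.2 = ∑ q ∈ S ×ˢ S, w q * kiteDist ω (p q.1) (p q.2) →
      ∀ u ∈ S, ∀ v ∈ S, d u v = kiteDist ω (p u) (p v))

theorem IsNumbering.exists_eq {V : Type*} {S : Finset V} {p : V → ℕ} (hp : IsNumbering S p) {i : ℕ}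
    (hi : i < S.card) : ∃ u ∈ S, p u = i := by
  have := Finset.surj_on_of_inj_on_of_card_le (s := S) (t := Finset.range S.card)
    (fun u _ => p u) (fun u hu => Finset.mem_range.2 (hp.lt u hu))
    (fun u v hu hv h => hp.inj u hu v hv h) (by simp) i (Finset.mem_range.2 hi)
  obtain ⟨u, hu, h⟩ := this
  exact ⟨u, hu, h.symm⟩

theorem IsNumbering.comp {V : Type*} {S : Finset V} {p : V → ℕ} (hp : IsNumbering S p) {σ : ℕ → ℕ}
    (hσ : IsRenumbering S.card σ) : IsNumbering S (fun u => σ (p u)) :=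
  ⟨fun u hu => hσ.lt _ (hp.lt u hu),
    fun u hu v hv h => hp.inj u hu v hv (hσ.inj _ (hp.lt u hu) _ (hp.lt v hv) h)⟩

theorem dominatedByKites_clique {V : Type*} {ω : ℕ} {d : V → V → ℕ} {K : Finset V}
    (hK : K.card = ω) (h0 : ∀ u, d u u = 0) (h1 : ∀ u ∈ K, ∀ v ∈ K, u ≠ v → d u v = 1) :
    DominatedByKites ω d K := by
  classical
  intro w _
  obtain ⟨p, hp⟩ : ∃ p : V → ℕ, IsNumbering K p := by
    refine ⟨fun u => if h : u ∈ K then K.equivFin ⟨u, h⟩ else 0, fun u hu => ?_,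
      fun u hu v hv h => ?_⟩
    · simp [hu]
    · simpa [hu, hv, Fin.val_inj] using h
  have h : ∀ u ∈ K, ∀ v ∈ K, d u v = kiteDist ω (p u) (p v) := by
    intro u hu v hv
    by_cases huv : u = v
    · rw [huv, h0, kiteDist_of_eq rfl]
    · rw [h1 u hu v hv huv, kiteDist_clique (fun h => huv (hp.inj u hu v hv h))
        (hK ▸ hp.lt u hu) (hK ▸ hp.lt v hv)]
  refine ⟨p, hp, (Finset.sum_congr rfl fun q hq => ?_).le, fun _ => h⟩
  rw [Finset.mem_product] at hq
  rw [h _ hq.1 _ hq.2]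

theorem sum_insert_product {V : Type*} [DecidableEq V] {S : Finset V} {z : V} (hz : z ∉ S)
    (f : V × V → ℝ) :
    ∑ q ∈ insert z S ×ˢ insert z S, f q =
      f (z, z) + ∑ u ∈ S, (f (z, u) + f (u, z)) + ∑ q ∈ S ×ˢ S, f q := by
  rw [Finset.sum_product, Finset.sum_product, Finset.sum_insert hz, Finset.sum_insert hz,
    Finset.sum_add_distrib]
  simp_rw [Finset.sum_insert hz]
  rw [Finset.sum_add_distrib]
  ring

theorem DominatedByKites.insert_vertex {V : Type*} [DecidableEq V] {ω : ℕ} (hω : 2 ≤ ω) {d : V → V → ℕ}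
    {S : Finset V} (hS : DominatedByKites ω d S) (hωS : ω ≤ S.card) {z y : V} (hz : z ∉ S)
    (hy : y ∈ S) (h0 : ∀ u, d u u = 0) (hcomm : ∀ u v, d u v = d v u)
    (hle : ∀ u, d z u ≤ 1 + d y u) :
    DominatedByKites ω d (insert z S) := by
  intro w hw
  set k := S.card with hk
  have hcard : (insert z S).card = k + 1 := Finset.card_insert_of_notMem hz
  -- the weights of the new vertex are added to those of its neighbour
  set w' : V × V → ℝ := fun q => w q + ((if q.1 = y then w (z, q.2) else 0) +
    if q.2 = y then w (q.1, z) else 0) with hw'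
  have hw'_pos : ∀ q, 0 < w' q := fun q => by
    simp only [hw']
    have := hw q
    have := hw (z, q.2)
    have := hw (q.1, z)
    split_ifs <;> linarith
  have hsum' : ∀ f : V × V → ℝ, ∑ q ∈ S ×ˢ S, w' q * f q =
      ∑ q ∈ S ×ˢ S, w q * f q + ∑ u ∈ S, (w (z, u) * f (y, u) + w (u, z) * f (u, y)) := by
    intro f
    simp only [hw', add_mul, Finset.sum_add_distrib, ite_mul, zero_mul]
    congr 2
    · rw [Finset.sum_product]
      simp [Finset.sum_ite_irrel, hy]
    · rw [Finset.sum_product]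
      simp [hy]
  obtain ⟨p, hp, hple, hpeq⟩ := hS w' hw'_pos
  set p₁ : V → ℕ := fun u => if u = z then k else p u with hp₁
  have hp₁z : p₁ z = k := if_pos rfl
  have hp₁S : ∀ u ∈ S, p₁ u = p u := fun u hu => if_neg (by rintro rfl; exact hz hu)
  have hnum : IsNumbering (insert z S) p₁ := by
    constructor
    · intro u hu
      rcases Finset.mem_insert.1 hu with rfl | hu
      · omega
      · have := hp.lt u hu
        rw [hp₁S u hu]; omega
    · intro u hu v hv h
      rcases Finset.mem_insert.1 hu with rfl | hu' <;> rcases Finset.mem_insert.1 hv with rfl | hv'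
      · rfl
      · have := hp.lt v hv'
        rw [hp₁S v hv'] at h; omega
      · have := hp.lt u hu'
        rw [hp₁S u hu'] at h; omega
      · rw [hp₁S u hu', hp₁S v hv'] at h
        exact hp.inj u hu' v hv' h
  -- the distance after joining the new vertex to a kite on `S`
  set e : V → V → ℕ := fun u v => pendantKiteDist ω k (p y) (p₁ u) (p₁ v) with he
  have he_zz : e z z = 0 := if_pos rfl
  have he_z : ∀ u ∈ S, e z u = 1 + kiteDist ω (p y) (p u) := fun u hu => by
    have := hp.lt u hu
    simp only [he, pendantKiteDist, hp₁z, hp₁S u hu]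
    rw [if_neg (by omega), if_pos trivial]
  have he_comm : ∀ u v, e u v = e v u := fun u v => pendantKiteDist_comm _ _ _ _ _
  have he_S : ∀ u ∈ S, ∀ v ∈ S, e u v = kiteDist ω (p u) (p v) := fun u hu v hv => by
    have := hp.lt u hu
    have := hp.lt v hv
    simp only [he, pendantKiteDist, hp₁S v hv, hp₁S u hu]
    by_cases h : p u = p v
    · rw [if_pos h, kiteDist_of_eq h]
    · rw [if_neg h, if_neg (by omega), if_neg (by omega)]
  have hde : ∑ q ∈ insert z S ×ˢ insert z S, w q * d q.1 q.2 ≤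
        ∑ q ∈ insert z S ×ˢ insert z S, w q * e q.1 q.2 ∧
      (∑ q ∈ insert z S ×ˢ insert z S, w q * d q.1 q.2 =
        ∑ q ∈ insert z S ×ˢ insert z S, w q * e q.1 q.2 →
          ∀ u ∈ insert z S, ∀ v ∈ insert z S, d u v = e u v) := by
    rw [sum_insert_product hz, sum_insert_product hz]
    simp only [h0, he_zz, Nat.cast_zero, mul_zero, zero_add]
    -- Replacing `z` by `y` costs at most the constant `w (z, u) + w (u, z)`; what remains is the
    -- sum over `S` with weights `w'`.
    have hterm : ∀ u ∈ S, w (z, u) * d z u + w (u, z) * d u z ≤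
        (w (z, u) + w (u, z)) + (w (z, u) * d y u + w (u, z) * d u y) := fun u _ => by
      have h : (d z u : ℝ) ≤ 1 + d y u := by exact_mod_cast hle u
      rw [hcomm u z, hcomm u y]
      nlinarith [mul_le_mul_of_nonneg_left h (hw (z, u)).le,
        mul_le_mul_of_nonneg_left h (hw (u, z)).le]
    have h1 := Finset.sum_le_sum hterm
    rw [Finset.sum_add_distrib (f := fun u => w (z, u) + w (u, z))] at h1
    have h2 := hsum' (fun q => d q.1 q.2)
    have h3 := hsum' (fun q => kiteDist ω (p q.1) (p q.2))
    have h4 : ∑ u ∈ S, (w (z, u) * e z u + w (u, z) * e u z) = ∑ u ∈ S, (w (z, u) + w (u, z)) +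
        ∑ u ∈ S, (w (z, u) * kiteDist ω (p y) (p u) + w (u, z) * kiteDist ω (p u) (p y)) := by
      rw [← Finset.sum_add_distrib]
      refine Finset.sum_congr rfl fun u hu => ?_
      rw [he_comm u z, he_z u hu, kiteDist_comm ω (p u) (p y)]
      push_cast; ring
    have h5 : ∑ q ∈ S ×ˢ S, w q * e q.1 q.2 =
        ∑ q ∈ S ×ˢ S, w q * kiteDist ω (p q.1) (p q.2) := by
      refine Finset.sum_congr rfl fun q hq => ?_
      rw [Finset.mem_product] at hq
      rw [he_S _ hq.1 _ hq.2]
    dsimp only at h2 h3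
    -- Equality of the totals makes both the induction bound and every term of `hterm` tight.
    refine ⟨by linarith, fun heq => ?_⟩
    have hSeq := hpeq (by linarith)
    have hzeq : ∀ u ∈ S, d z u = e z u := by
      intro u hu
      have h6 := (Finset.sum_eq_sum_iff_of_le hterm).1
        (by rw [Finset.sum_add_distrib (f := fun u => w (z, u) + w (u, z))]; linarith) u hu
      have h7 : (d z u : ℝ) = 1 + d y u := by
        rw [hcomm u z, hcomm u y] at h6
        have : (w (z, u) + w (u, z)) * (d z u : ℝ) = (w (z, u) + w (u, z)) * (1 + d y u) := by
          linarith
        exact mul_left_cancel₀ (add_pos (hw _) (hw _)).ne' this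
      rw [he_z u hu, ← hSeq y hy u hu]
      exact_mod_cast h7
    intro u hu v hv
    rcases Finset.mem_insert.1 hu with rfl | hu' <;> rcases Finset.mem_insert.1 hv with rfl | hv'
    · rw [h0, he_zz]
    · exact hzeq v hv'
    · rw [hcomm, he_comm, hzeq u hu']
    · rw [he_S u hu' v hv', hSeq u hu' v hv']
  have hp₁lt : ∀ u ∈ insert z S, p₁ u < k + 1 := fun u hu => hcard ▸ hnum.lt u hu
  rcases exists_renumbering hω hωS (hp.lt y hy) with ⟨σ, hσ, hσe⟩ | ⟨σ₁, σ₂, hσ₁, hσ₂, a, b, hab, i,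
    hi, j, hj, hlt⟩
  · have he' : ∀ u ∈ insert z S, ∀ v ∈ insert z S, e u v = kiteDist ω (σ (p₁ u)) (σ (p₁ v)) :=
      fun u hu v hv => hσe _ (hp₁lt u hu) _ (hp₁lt v hv)
    have hsum : ∑ q ∈ insert z S ×ˢ insert z S, w q * e q.1 q.2 =
        ∑ q ∈ insert z S ×ˢ insert z S, w q * kiteDist ω (σ (p₁ q.1)) (σ (p₁ q.2)) := by
      refine Finset.sum_congr rfl fun q hq => ?_
      rw [Finset.mem_product] at hq
      rw [he' _ hq.1 _ hq.2]
    refine ⟨fun u => σ (p₁ u), hnum.comp (hcard ▸ hσ), hsum ▸ hde.1, fun h u hu v hv => ?_⟩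
    rw [hde.2 (h.trans hsum.symm) u hu v hv, he' u hu v hv]
  · obtain ⟨u, hu, rfl⟩ := hnum.exists_eq (hcard ▸ hi)
    obtain ⟨v, hv, rfl⟩ := hnum.exists_eq (hcard ▸ hj)
    -- A strictly larger sum makes the equality clause vacuous.
    have hstrict : ∀ σ, IsRenumbering (k + 1) σ → ∑ q ∈ insert z S ×ˢ insert z S, w q * e q.1 q.2 <
        ∑ q ∈ insert z S ×ˢ insert z S, w q * kiteDist ω (σ (p₁ q.1)) (σ (p₁ q.2)) →
        ∃ p : V → ℕ, IsNumbering (insert z S) p ∧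
          ∑ q ∈ insert z S ×ˢ insert z S, w q * d q.1 q.2 ≤
            ∑ q ∈ insert z S ×ˢ insert z S, w q * kiteDist ω (p q.1) (p q.2) ∧
          (∑ q ∈ insert z S ×ˢ insert z S, w q * d q.1 q.2 =
            ∑ q ∈ insert z S ×ˢ insert z S, w q * kiteDist ω (p q.1) (p q.2) →
            ∀ u ∈ insert z S, ∀ v ∈ insert z S, d u v = kiteDist ω (p u) (p v)) :=
      fun σ hσ h => ⟨fun u => σ (p₁ u), hnum.comp (hcard ▸ hσ), (hde.1.trans_lt h).le,
        fun h' => absurd h' (hde.1.trans_lt h).ne⟩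
    rcases sum_lt_or_sum_lt (insert z S ×ˢ insert z S) w (fun q _ => hw q) (fun q => e q.1 q.2)
      (fun q => kiteDist ω (σ₁ (p₁ q.1)) (σ₁ (p₁ q.2)))
      (fun q => kiteDist ω (σ₂ (p₁ q.1)) (σ₂ (p₁ q.2))) a b
      (fun q hq => by
        rw [Finset.mem_product] at hq
        exact hab _ (hp₁lt _ hq.1) _ (hp₁lt _ hq.2))
      ⟨(u, v), Finset.mem_product.2 ⟨hu, hv⟩, hlt⟩ with h | h
    · exact hstrict σ₁ hσ₁ h
    · exact hstrict σ₂ hσ₂ h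

theorem SimpleGraph.Connected.dominatedByKites {V : Type*} [Fintype V] [DecidableEq V]
    {G : SimpleGraph V} (hG : G.Connected) {ω : ℕ} (hω : 2 ≤ ω) {K : Finset V}
    (hK : G.IsNClique ω K) : DominatedByKites ω G.dist Finset.univ := by
  have key : ∀ m : ℕ, ω + m ≤ Fintype.card V →
      ∃ S : Finset V, S.card = ω + m ∧ DominatedByKites ω G.dist S := by
    intro m
    induction m with
    | zero =>
      intro _
      refine ⟨K, hK.card_eq, dominatedByKites_clique hK.card_eq (fun u => G.dist_self) ?_⟩
      intro u hu v hv huv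
      exact SimpleGraph.dist_eq_one_iff_adj.2 (hK.isClique hu hv huv)
    | succ m ih =>
      intro hm
      obtain ⟨S, hS, hdom⟩ := ih (by omega)
      obtain ⟨s, hs⟩ : S.Nonempty := Finset.card_pos.1 (by omega)
      obtain ⟨t, ht⟩ : ∃ t, t ∉ S := by
        by_contra! h
        have := Finset.card_univ (α := V)
        rw [← Finset.eq_univ_iff_forall.2 h] at this
        omega
      obtain ⟨p⟩ := hG.preconnected s t
      -- A walk leaving `S` crosses an edge from some `y ∈ S` to the new vertex `z ∉ S`.
      obtain ⟨q, -, hy, hz⟩ := p.exists_boundary_dart (S : Set V) (by simpa using hs)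
        (by simpa using ht)
      have hz' : q.snd ∉ S := by simpa using hz
      refine ⟨insert q.snd S, by rw [Finset.card_insert_of_notMem hz', hS]; omega,
        hdom.insert_vertex hω (by omega) hz' (y := q.fst) (by simpa using hy) (fun u => G.dist_self)
          (fun u v => G.dist_comm) fun u => ?_⟩
      have h1 := hG.dist_triangle (u := q.snd) (v := q.fst) (w := u)
      have h2 : G.dist q.snd q.fst = 1 := SimpleGraph.dist_eq_one_iff_adj.2 q.adj.symm
      omega
  have hle : ω ≤ Fintype.card V := hK.card_eq ▸ Finset.card_le_univ K
  obtain ⟨S, hS, hdom⟩ := key (Fintype.card V - ω) (by omega)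
  rwa [(Finset.card_eq_iff_eq_univ S).1 (by omega)] at hdom

/-! ### The quadratic form and the positive eigenvector -/

theorem distAlphaMatrix_apply {V : Type*} [Fintype V] [DecidableEq V] (α : ℝ) (G : SimpleGraph V)
    (u v : V) : distAlphaMatrix α G u v =
      α * (if u = v then ∑ t, (G.dist u t : ℝ) else 0) + (1 - α) * G.dist u v := by
  simp [distAlphaMatrix, Matrix.diagonal_apply]

theorem distAlphaMatrix_isHermitian {V : Type*} [Fintype V] [DecidableEq V] (α : ℝ)
    (G : SimpleGraph V) : (distAlphaMatrix α G).IsHermitian := by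
  ext u v
  rw [Matrix.conjTranspose_apply, star_trivial, distAlphaMatrix_apply, distAlphaMatrix_apply,
    G.dist_comm (u := v)]
  by_cases h : u = v
  · subst h; rfl
  · rw [if_neg h, if_neg (Ne.symm h)]

/-- Spreading each transmission over its summands makes the form linear in the distances; the
weights need not be symmetric. -/
theorem distAlphaMatrix_quadratic {V : Type*} [Fintype V] [DecidableEq V] (α : ℝ)
    (G : SimpleGraph V) (x : V → ℝ) : x ⬝ᵥ distAlphaMatrix α G *ᵥ x =
      ∑ q : V × V, (α * x q.1 ^ 2 + (1 - α) * (x q.1 * x q.2)) * G.dist q.1 q.2 := by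
  rw [Fintype.sum_prod_type]
  refine Finset.sum_congr rfl fun u _ => ?_
  simp only [Matrix.mulVec, dotProduct, distAlphaMatrix_apply, add_mul, mul_ite, ite_mul, mul_zero,
    zero_mul, Finset.sum_add_distrib, Finset.sum_ite_eq, Finset.mem_univ, if_true]
  rw [mul_add, Finset.mul_sum, Finset.mul_sum, Finset.sum_mul, Finset.mul_sum]
  congr 1 <;> exact Finset.sum_congr rfl fun v _ => by ring

theorem posSemidef_distAlphaRadius_sub {V : Type*} [Fintype V] [DecidableEq V] (α : ℝ)
    (G : SimpleGraph V) : (distAlphaRadius α G • (1 : Matrix V V ℝ) -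
      distAlphaMatrix α G).PosSemidef := by
  have hA := distAlphaMatrix_isHermitian α G
  have hH : (distAlphaRadius α G • (1 : Matrix V V ℝ) - distAlphaMatrix α G).IsHermitian := by
    refine Matrix.IsHermitian.sub ?_ hA
    rw [Matrix.IsHermitian, Matrix.conjTranspose_smul, Matrix.conjTranspose_one, star_trivial]
  rw [hH.posSemidef_iff_eigenvalues_nonneg]
  intro i
  have : Nonempty V := ⟨i⟩
  have hv := hH.mulVec_eigenvectorBasis i
  set v : V → ℝ := ⇑(hH.eigenvectorBasis i) with hvdef
  have hv0 : v ≠ 0 := by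
    intro h
    exact hH.eigenvectorBasis.orthonormal.ne_zero i (by ext t; exact congrFun h t)
  have hev : Module.End.HasEigenvalue (Matrix.toLin' (distAlphaMatrix α G))
      (distAlphaRadius α G - hH.eigenvalues i) := by
    refine Module.End.hasEigenvalue_of_hasEigenvector (x := v)
      ⟨Module.End.mem_eigenspace_iff.2 ?_, hv0⟩
    rw [Matrix.sub_mulVec, Matrix.smul_mulVec, Matrix.one_mulVec] at hv
    rw [Matrix.toLin'_apply, sub_smul, ← hv]
    abel
  have := (isGreatest_distAlphaRadius α G).2 hev
  simp only [Pi.zero_apply]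
  linarith

theorem quadratic_le_distAlphaRadius {V : Type*} [Fintype V] [DecidableEq V] (α : ℝ)
    (G : SimpleGraph V) (x : V → ℝ) :
    x ⬝ᵥ distAlphaMatrix α G *ᵥ x ≤ distAlphaRadius α G * (x ⬝ᵥ x) := by
  have := (posSemidef_distAlphaRadius_sub α G).dotProduct_mulVec_nonneg x
  rw [Matrix.sub_mulVec, dotProduct_sub, Matrix.smul_mulVec, Matrix.one_mulVec, dotProduct_smul,
    star_trivial, smul_eq_mul] at this
  linarith

/-- The distance `α`-spectral radius of a connected graph has a positive eigenvector. -/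
theorem exists_pos_eigenvector {V : Type*} [Fintype V] [DecidableEq V] {α : ℝ} (hα0 : 0 ≤ α)
    (hα1 : α < 1) {G : SimpleGraph V} (hG : G.Connected) : ∃ x : V → ℝ, (∀ u, 0 < x u) ∧
      distAlphaMatrix α G *ᵥ x = distAlphaRadius α G • x := by
  have := hG.nonempty
  obtain ⟨v, hv, hv0⟩ := (isGreatest_distAlphaRadius α G).1.exists_hasEigenvector
  rw [Module.End.mem_eigenspace_iff, Matrix.toLin'_apply] at hv
  set x : V → ℝ := fun u => |v u| with hx
  have hxx : x ⬝ᵥ x = v ⬝ᵥ v := Finset.sum_congr rfl fun u _ => abs_mul_abs_self _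
  have hge : distAlphaRadius α G * (x ⬝ᵥ x) ≤ x ⬝ᵥ distAlphaMatrix α G *ᵥ x := by
    have : v ⬝ᵥ distAlphaMatrix α G *ᵥ v = distAlphaRadius α G * (x ⬝ᵥ x) := by
      rw [hv, dotProduct_smul, smul_eq_mul, hxx]
    rw [← this, distAlphaMatrix_quadratic, distAlphaMatrix_quadratic]
    refine Finset.sum_le_sum fun q _ => mul_le_mul_of_nonneg_right ?_ (Nat.cast_nonneg _)
    rw [hx, sq_abs, ← abs_mul]
    have := mul_le_mul_of_nonneg_left (le_abs_self (v q.1 * v q.2)) (sub_nonneg.2 hα1.le)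
    linarith
  -- Taking absolute values does not lower the form, so `x` is a zero of a positive semidefinite
  -- form and hence lies in its kernel.
  have hxe : distAlphaMatrix α G *ᵥ x = distAlphaRadius α G • x := by
    have h := ((posSemidef_distAlphaRadius_sub α G).dotProduct_mulVec_zero_iff x).1 (by
      rw [Matrix.sub_mulVec, dotProduct_sub, Matrix.smul_mulVec, Matrix.one_mulVec,
        dotProduct_smul, star_trivial, smul_eq_mul]
      linarith [quadratic_le_distAlphaRadius α G x])
    rw [Matrix.sub_mulVec, Matrix.smul_mulVec, Matrix.one_mulVec] at h
    exact (sub_eq_zero.1 h).symm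
  refine ⟨x, fun u => lt_of_le_of_ne (abs_nonneg _) fun h0 => hv0 ?_, hxe⟩
  -- If `x u = 0`, row `u` is a vanishing sum of nonnegative terms with positive off-diagonal
  -- entries, so all of `v` vanishes.
  have hsum : ∑ t, distAlphaMatrix α G u t * x t = 0 := by
    have := congrFun hxe u
    rw [Pi.smul_apply, ← h0, smul_zero] at this
    exact this
  have hnonneg : ∀ t ∈ Finset.univ, 0 ≤ distAlphaMatrix α G u t * x t := fun t _ => by
    refine mul_nonneg ?_ (abs_nonneg _)
    rw [distAlphaMatrix_apply]
    have := sub_nonneg.2 hα1.le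
    split_ifs <;> positivity
  have hzero := (Finset.sum_eq_zero_iff_of_nonneg hnonneg).1 hsum
  funext t
  by_cases htu : u = t
  · subst htu
    exact abs_eq_zero.1 h0.symm
  · have h := hzero t (Finset.mem_univ t)
    rw [distAlphaMatrix_apply, if_neg htu, mul_zero, zero_add] at h
    have hd : (0 : ℝ) < G.dist u t := by exact_mod_cast hG.pos_dist_of_ne htu
    have := (mul_eq_zero.1 h).resolve_left (mul_pos (sub_pos.2 hα1) hd).ne'
    exact abs_eq_zero.1 this

theorem SimpleGraph.Iso.dist_le {V W : Type*} {G : SimpleGraph V} {H : SimpleGraph W} (φ : G ≃g H)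
    (hG : G.Connected) (u v : V) : H.dist (φ u) (φ v) ≤ G.dist u v := by
  obtain ⟨p, hp⟩ := hG.exists_walk_length_eq_dist u v
  rw [← hp, ← SimpleGraph.Walk.length_map φ.toHom p]
  exact SimpleGraph.dist_le _

/-- The spectral radii compare as the distance sums with the weights that come from a positive
eigenvector. -/
theorem distAlphaRadius_le_of_sum_le {V W : Type*} [Fintype V] [DecidableEq V] [Fintype W]
    [DecidableEq W] {α : ℝ} {G : SimpleGraph V} {H : SimpleGraph W} [Nonempty V]
    {x : V → ℝ} (hx : ∀ u, 0 < x u)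
    (hxe : distAlphaMatrix α G *ᵥ x = distAlphaRadius α G • x) (φ : V ≃ W) :
    (∑ q : V × V, (α * x q.1 ^ 2 + (1 - α) * (x q.1 * x q.2)) * (G.dist q.1 q.2 : ℝ) ≤
      ∑ q : V × V, (α * x q.1 ^ 2 + (1 - α) * (x q.1 * x q.2)) * (H.dist (φ q.1) (φ q.2) : ℝ) →
        distAlphaRadius α G ≤ distAlphaRadius α H) ∧
    (∑ q : V × V, (α * x q.1 ^ 2 + (1 - α) * (x q.1 * x q.2)) * (G.dist q.1 q.2 : ℝ) <
      ∑ q : V × V, (α * x q.1 ^ 2 + (1 - α) * (x q.1 * x q.2)) * (H.dist (φ q.1) (φ q.2) : ℝ) →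
        distAlphaRadius α G < distAlphaRadius α H) := by
  have hpos : 0 < x ⬝ᵥ x :=
    Finset.sum_pos (fun u _ => mul_pos (hx u) (hx u)) Finset.univ_nonempty
  have h1 := distAlphaMatrix_quadratic α G x
  rw [hxe, dotProduct_smul, smul_eq_mul] at h1
  have h2 := quadratic_le_distAlphaRadius α H (fun t => x (φ.symm t))
  have h3 : (fun t => x (φ.symm t)) ⬝ᵥ (fun t => x (φ.symm t)) = x ⬝ᵥ x :=
    Equiv.sum_comp φ.symm (fun u => x u * x u)
  rw [distAlphaMatrix_quadratic, h3, ← Equiv.sum_comp (φ.prodCongr φ)] at h2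
  simp only [Equiv.prodCongr_apply, Prod.map_fst, Prod.map_snd, Equiv.symm_apply_apply] at h2
  rw [← h1]
  exact ⟨fun h => le_of_mul_le_mul_right (h.trans h2) hpos,
    fun h => lt_of_mul_lt_mul_right (h.trans_le h2) hpos.le⟩

theorem distAlphaRadius_le_of_iso {V W : Type*} [Fintype V] [DecidableEq V] [Fintype W]
    [DecidableEq W] {α : ℝ} (hα0 : 0 ≤ α) (hα1 : α < 1) {G : SimpleGraph V} {H : SimpleGraph W}
    (hG : G.Connected) (φ : G ≃g H) : distAlphaRadius α G ≤ distAlphaRadius α H := by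
  have := hG.nonempty
  obtain ⟨x, hx, hxe⟩ := exists_pos_eigenvector hα0 hα1 hG
  refine (distAlphaRadius_le_of_sum_le hx hxe φ.toEquiv).1 (Finset.sum_le_sum fun q _ => ?_)
  have hα := sub_nonneg.2 hα1.le
  have h1 := (hx q.1).le
  have h2 := (hx q.2).le
  refine mul_le_mul_of_nonneg_left ?_ (by positivity)
  have := φ.symm.dist_le (φ.connected_iff.1 hG) (φ q.1) (φ q.2)
  rw [φ.symm_apply_apply, φ.symm_apply_apply] at this
  exact_mod_cast this

/-! ### The kite graph and the final comparison -/

theorem kiteDist_triangle {ω : ℕ} (i j l : ℕ) :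
    kiteDist ω i l ≤ kiteDist ω i j + kiteDist ω j l := by
  unfold kiteDist
  split_ifs <;> omega

theorem kiteDist_eq_one_iff {n ω : ℕ} (hω : 2 ≤ ω) (i j : Fin n) :
    kiteDist ω i j = 1 ↔ (kiteGraph n ω).Adj i j := by
  have hadj : (kiteGraph n ω).Adj i j ↔ (i : ℕ) ≠ j ∧
      (((i : ℕ) < ω ∧ (j : ℕ) < ω) ∨ (i : ℕ) + 1 = j ∨ (j : ℕ) + 1 = i) :=
    and_congr_left' Fin.val_ne_iff.symm
  rw [hadj]
  unfold kiteDist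
  by_cases h : (i : ℕ) = j
  · simp [h]
  · rw [if_neg h]; omega

theorem kiteDist_le_length {n ω : ℕ} (hω : 2 ≤ ω) {i j : Fin n} (p : (kiteGraph n ω).Walk i j) :
    kiteDist ω i j ≤ p.length := by
  induction p with
  | nil => rw [kiteDist_of_eq rfl]; exact Nat.zero_le _
  | cons h p ih =>
    rw [SimpleGraph.Walk.length_cons]
    have := (kiteDist_eq_one_iff hω _ _).2 h
    refine (kiteDist_triangle _ _ _).trans (Nat.le_trans (Nat.add_le_add this.le ih) ?_)
    omega

theorem kiteGraph_connected {n ω : ℕ} (hn : 0 < n) : (kiteGraph n ω).Connected := by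
  have : Nonempty (Fin n) := ⟨⟨0, hn⟩⟩
  have key : ∀ m (hm : m < n), (kiteGraph n ω).Reachable ⟨0, hn⟩ ⟨m, hm⟩ := by
    intro m
    induction m with
    | zero => intro hm; exact SimpleGraph.Reachable.refl _
    | succ m ih =>
      intro hm
      refine (ih (by omega)).trans (SimpleGraph.Adj.reachable ⟨?_, Or.inr (Or.inl rfl)⟩)
      simp
  exact ⟨fun i j => (key i i.2).symm.trans (key j j.2)⟩

/-- Colouring by residues modulo `ω` gives the upper bound. -/
theorem kiteGraph_cliqueNum {n ω : ℕ} (hω : 2 ≤ ω) (hωn : ω ≤ n) :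
    (kiteGraph n ω).cliqueNum = ω := by
  apply le_antisymm
  · obtain ⟨s, hs⟩ := (kiteGraph n ω).exists_isNClique_cliqueNum
    rw [← hs.card_eq]
    let C : (kiteGraph n ω).Coloring (Fin ω) := SimpleGraph.Coloring.mk
      (fun i => ⟨(i : ℕ) % ω, Nat.mod_lt _ (by omega)⟩) (by
        have hsucc : ∀ a : ℕ, a % ω ≠ (a + 1) % ω := fun a h => by
          have h' : (ω : ℕ) ∣ a + 1 - a := (Nat.modEq_iff_dvd' (Nat.le_succ a)).1 h
          rw [Nat.add_sub_cancel_left, Nat.dvd_one] at h'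
          omega
        rintro i j ⟨hij, h | h | h⟩ heq <;> rw [Fin.mk.injEq] at heq
        · rw [Nat.mod_eq_of_lt h.1, Nat.mod_eq_of_lt h.2] at heq
          exact hij (Fin.ext heq)
        · exact hsucc i (h ▸ heq)
        · exact hsucc j (h ▸ heq.symm))
    simpa using hs.isClique.card_le_of_coloring C
  · have hc : (kiteGraph n ω).IsClique (Finset.univ.map (Fin.castLEEmb hωn) : Finset (Fin n)) := by
      intro i hi j hj hij
      simp only [Finset.coe_map, Finset.coe_univ, Set.image_univ, Set.mem_range] at hi hj
      obtain ⟨i, rfl⟩ := hi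
      obtain ⟨j, rfl⟩ := hj
      exact ⟨hij, Or.inl ⟨by simp, by simp⟩⟩
    simpa using hc.card_le_cliqueNum

theorem mainTheorem2 (α : ℝ) (hα0 : 0 ≤ α) (hα1 : α < 1) (n ω : ℕ) (hω : 2 ≤ ω) (hωn : ω ≤ n) :
    ((kiteGraph n ω).Connected ∧ (kiteGraph n ω).cliqueNum = ω) ∧
    ∀ (V : Type*) [Fintype V] [DecidableEq V] (G : SimpleGraph V),
      Fintype.card V = n → G.Connected → G.cliqueNum = ω →
        distAlphaRadius α G ≤ distAlphaRadius α (kiteGraph n ω) ∧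
        (distAlphaRadius α G = distAlphaRadius α (kiteGraph n ω) ↔
          Nonempty (G ≃g kiteGraph n ω)) := by
  have hconn : (kiteGraph n ω).Connected := kiteGraph_connected (by omega)
  refine ⟨⟨hconn, kiteGraph_cliqueNum hω hωn⟩, ?_⟩
  intro V _ _ G hV hG hcl
  have := hG.nonempty
  obtain ⟨K, hK⟩ := G.exists_isNClique_cliqueNum
  rw [hcl] at hK
  obtain ⟨x, hx, hxe⟩ := exists_pos_eigenvector hα0 hα1 hG
  have hw : ∀ q : V × V, 0 < α * x q.1 ^ 2 + (1 - α) * (x q.1 * x q.2) := fun q =>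
    add_pos_of_nonneg_of_pos (by positivity) (mul_pos (sub_pos.2 hα1) (mul_pos (hx _) (hx _)))
  obtain ⟨p, hp, hle, heq⟩ := hG.dominatedByKites hω hK _ hw
  have hplt : ∀ u, p u < n := fun u => by
    have := hp.lt u (Finset.mem_univ u)
    rwa [Finset.card_univ, hV] at this
  let φ : V ≃ Fin n := Equiv.ofBijective (fun u => ⟨p u, hplt u⟩) (by
    rw [Fintype.bijective_iff_injective_and_card]
    refine ⟨fun u v h => hp.inj u (Finset.mem_univ u) v (Finset.mem_univ v) ?_, by simpa using hV⟩
    exact congrArg Fin.val h)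
  have hφ : ∀ u, ((φ u : Fin n) : ℕ) = p u := fun u => rfl
  rw [Finset.univ_product_univ] at hle heq
  -- Only the bound of `kiteDist` by the graph distance is needed.
  have hkite : ∑ q : V × V, (α * x q.1 ^ 2 + (1 - α) * (x q.1 * x q.2)) *
        (kiteDist ω (p q.1) (p q.2) : ℝ) ≤
      ∑ q : V × V, (α * x q.1 ^ 2 + (1 - α) * (x q.1 * x q.2)) *
        ((kiteGraph n ω).dist (φ q.1) (φ q.2) : ℝ) := by
    refine Finset.sum_le_sum fun q _ => mul_le_mul_of_nonneg_left ?_ (hw q).le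
    obtain ⟨r, hr⟩ := hconn.exists_walk_length_eq_dist (φ q.1) (φ q.2)
    rw [← hr]
    exact_mod_cast kiteDist_le_length hω r
  have hcmp := distAlphaRadius_le_of_sum_le (H := kiteGraph n ω) hx hxe φ
  refine ⟨hcmp.1 (hle.trans hkite), fun h => ?_, fun ⟨ψ⟩ =>
    (distAlphaRadius_le_of_iso hα0 hα1 hG ψ).antisymm
      (distAlphaRadius_le_of_iso hα0 hα1 hconn ψ.symm)⟩
  -- A strict distance sum would give a strict radius, so the distances agree; adjacency is distance
  -- 1.
  have hdist := heq (hle.eq_of_not_lt fun hlt => (hcmp.2 (hlt.trans_le hkite)).ne h)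
  refine ⟨⟨φ, fun {u v} => ?_⟩⟩
  rw [← kiteDist_eq_one_iff hω, hφ, hφ, ← hdist u (Finset.mem_univ u) v (Finset.mem_univ v),
    SimpleGraph.dist_eq_one_iff_adj]
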